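/- Let $\alpha_1,\alpha_2,\beta_1,\beta_2>0$ and let $\{X(t):t\ge 0\}$ be a (time-homogeneous) continuous-time Markov chain on $\mathbb{Z}$ with state probabilities $p_{k,n}(t)=P(X(t)=n\mid X(0)=k)$, $p_{k,n}(0)=1_{\{k=n\}}$, whose generator $g_{k,n}=\lim_{t\to 0^+}\frac{p_{k,n}(t)-p_{k,n}(0)}{t}$ is given by $$g_{k,k+1}=\alpha_1,\quad g_{k,k-1}=\alpha_2,\quad g_{k,k}=-(\alpha_1+\alpha_2)\qquad (k \text{ even}),$$ $$g_{k,k+1}=\beta_1,\quad g_{k,k-1}=\beta_2,\quad g_{k,k}=-(\beta_1+\beta_2)\qquad (k \text{ odd}),$$ and $g_{k,n}=0$ if $|k-n|\ge 2$. Binomial coefficients with a negative argument are equal to zero, and $0^0=1$. For $r,s\in\mathbb{Z}$ and integers $n\ge 0$ put, if $\alpha_1+\alpha_2\ne\beta_1+\beta_2$, $$\vartheta^n_{r,s}(\alpha_1,\alpha_2,\beta_1,\beta_2):=\left(\tfrac{4\alpha_2\beta_2}{(\alpha_1+\alpha_2-\beta_1-\beta_2)^2}\right)^{s-r}\sum_{h=0}^{n-s+r}\binom{n}{h+s-r}\left(\tfrac{4\alpha_1\beta_2}{(\alpha_1+\alpha_2-\beta_1-\beta_2)^2}\right)^{h}\sum_{l=0}^{h}\binom{h+s-r}{l}\binom{h+s-r}{h-l}\left(\tfrac{\alpha_2\beta_1}{\alpha_1\beta_2}\right)^{l},$$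 and, if $\alpha_1+\alpha_2=\beta_1+\beta_2$, $$\eta^n_{r,s}(\alpha_1,\alpha_2,\beta_1,\beta_2):=\left(\tfrac{\alpha_2}{\alpha_1}\right)^{s-r}(\alpha_1\beta_2)^n\sum_{l=0}^{n-s+r}\binom{n}{l}\binom{n}{s-r+l}\left(\tfrac{\alpha_2\beta_1}{\alpha_1\beta_2}\right)^{l}.$$ Write $q:=\frac{\alpha_1\beta_1}{\alpha_2\beta_2}$, $\delta:=\frac{\beta_1+\beta_2-\alpha_1-\alpha_2}{2}$ and $\sigma:=\frac{\alpha_1+\alpha_2+\beta_1+\beta_2}{2}$. All the series below converge, and the following hold. (i) If $\alpha_1+\alpha_2\ne\beta_1+\beta_2$, then for all $r,s\in\mathbb{Z}$ and $t\ge 0$: $$p_{2r,2s}(t)=e^{-\sigma t}\sum_{n=|s-r|}^{\infty}q^{s-r}\left[\tfrac{t^{2n}}{(2n)!}\delta^{2n}+\tfrac{t^{2n+1}}{(2n+1)!}\delta^{2n+1}\right]\vartheta^n_{r,s}(\alpha_1,\alpha_2,\beta_1,\beta_2);$$ $$p_{2r,2s+1}(t)=e^{-\sigma t}\left\{\alpha_1\sum_{n=|s-r|}^{\infty}\tfrac{t^{2n+1}}{(2n+1)!}\delta^{2n}q^{s-r}\vartheta^n_{r,s}(\alpha_1,\alpha_2,\beta_1,\beta_2)+\alpha_2\sum_{n=|s-r+1|}^{\infty}\tfrac{t^{2n+1}}{(2n+1)!}\delta^{2n}q^{s-r+1}\vartheta^n_{r,s+1}(\alpha_1,\alpha_2,\beta_1,\beta_2)\right\};$$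 $$p_{2r+1,2s}(t)=e^{-\sigma t}\left\{\beta_2\sum_{n=|s-r|}^{\infty}\tfrac{t^{2n+1}}{(2n+1)!}\delta^{2n}q^{s-r}\vartheta^n_{r,s}(\beta_1,\beta_2,\alpha_1,\alpha_2)+\beta_1\sum_{n=|s-r-1|}^{\infty}\tfrac{t^{2n+1}}{(2n+1)!}\delta^{2n}q^{s-r-1}\vartheta^n_{r,s-1}(\beta_1,\beta_2,\alpha_1,\alpha_2)\right\};$$ $$p_{2r+1,2s+1}(t)=e^{-\sigma t}\sum_{n=|s-r|}^{\infty}q^{s-r}\left[\tfrac{t^{2n}}{(2n)!}\delta^{2n}+\tfrac{t^{2n+1}}{(2n+1)!}(-\delta)^{2n+1}\right]\vartheta^n_{r,s}(\beta_1,\beta_2,\alpha_1,\alpha_2).$$ (ii) If $\alpha_1+\alpha_2=\beta_1+\beta_2$, then for all $r,s\in\mathbb{Z}$ and $t\ge 0$: $$p_{2r,2s}(t)=e^{-(\alpha_1+\alpha_2)t}\sum_{n=|s-r|}^{\infty}q^{s-r}\tfrac{t^{2n}}{(2n)!}\eta^n_{r,s}(\alpha_1,\alpha_2,\beta_1,\beta_2);$$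 $$p_{2r,2s+1}(t)=e^{-(\alpha_1+\alpha_2)t}\left\{\alpha_1\sum_{n=|s-r|}^{\infty}\tfrac{t^{2n+1}}{(2n+1)!}q^{s-r}\eta^n_{r,s}(\alpha_1,\alpha_2,\beta_1,\beta_2)+\alpha_2\sum_{n=|s-r+1|}^{\infty}\tfrac{t^{2n+1}}{(2n+1)!}q^{s-r+1}\eta^n_{r,s+1}(\alpha_1,\alpha_2,\beta_1,\beta_2)\right\};$$ $$p_{2r+1,2s}(t)=e^{-(\alpha_1+\alpha_2)t}\left\{\beta_2\sum_{n=|s-r|}^{\infty}\tfrac{t^{2n+1}}{(2n+1)!}q^{s-r}\eta^n_{r,s}(\beta_1,\beta_2,\alpha_1,\alpha_2)+\beta_1\sum_{n=|s-r-1|}^{\infty}\tfrac{t^{2n+1}}{(2n+1)!}q^{s-r-1}\eta^n_{r,s-1}(\beta_1,\beta_2,\alpha_1,\alpha_2)\right\};$$ $$p_{2r+1,2s+1}(t)=e^{-(\alpha_1+\alpha_2)t}\sum_{n=|s-r|}^{\infty}\tfrac{t^{2n}}{(2n)!}q^{s-r}\eta^n_{r,s}(\beta_1,\beta_2,\alpha_1,\alpha_2).$$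 -/

import Mathlib

open MeasureTheory Filter Topology
open scoped NNReal

noncomputable section

namespace AlternatingChain

/-- A (time-homogeneous) continuous-time Markov chain on `ℤ`, given as a process `X` on a
measurable space `Ω` together with the probability measures `P k = ℙ(· | X(0) = k)`.
The Markov property is the usual one with respect to the natural filtration of `X`:
given the past up to time `s` and `X(s) = m`, the variable `X(s + t)` has the law of `X(t)`
under `P m`. -/
structure IsMarkovChain {Ω : Type*} [MeasurableSpace Ω]
    (P : ℤ → Measure Ω) (X : ℝ≥0 → Ω → ℤ) : Prop where
  isProb : ∀ k, IsProbabilityMeasure (P k)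
  measurable : ∀ t, Measurable (X t)
  start : ∀ k, P k (X 0 ⁻¹' {k}) = 1
  markov : ∀ (k : ℤ) (s t : ℝ≥0) (m n : ℤ) (A : Set Ω),
    MeasurableSet[⨆ u : Set.Iic s, MeasurableSpace.comap (X u) inferInstance] A →
      P k (A ∩ X s ⁻¹' {m} ∩ X (s + t) ⁻¹' {n})
        = P k (A ∩ X s ⁻¹' {m}) * P m (X t ⁻¹' {n})

/-- The state probabilities `p_{k,n}(t) = ℙ(X(t) = n | X(0) = k)`. -/
def stateProb {Ω : Type*} [MeasurableSpace Ω] (P : ℤ → Measure Ω) (X : ℝ≥0 → Ω → ℤ)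
    (k n : ℤ) (t : ℝ≥0) : ℝ :=
  (P k).real (X t ⁻¹' {n})

/-- `G` is the generator of the chain: `g_{k,n} = lim_{t → 0+} (p_{k,n}(t) - p_{k,n}(0)) / t`. -/
def HasGenerator {Ω : Type*} [MeasurableSpace Ω] (P : ℤ → Measure Ω) (X : ℝ≥0 → Ω → ℤ)
    (G : ℤ → ℤ → ℝ) : Prop :=
  ∀ k n : ℤ, Tendsto (fun t : ℝ≥0 => (stateProb P X k n t - stateProb P X k n 0) / (t : ℝ))
    (𝓝[>] 0) (𝓝 (G k n))

/-- The generator with alternating rates: from an even state, up at rate `α₁` and down at rate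
`α₂`; from an odd state, up at rate `β₁` and down at rate `β₂`. -/
def rates (α₁ α₂ β₁ β₂ : ℝ) (k n : ℤ) : ℝ :=
  if n = k + 1 then (if Even k then α₁ else β₁)
  else if n = k - 1 then (if Even k then α₂ else β₂)
  else if n = k then (if Even k then -(α₁ + α₂) else -(β₁ + β₂))
  else 0

/-- Binomial coefficient with integer arguments, zero as soon as an argument is negative. -/
def binom (a b : ℤ) : ℝ :=
  if 0 ≤ a ∧ 0 ≤ b then (a.toNat.choose b.toNat : ℝ) else 0

/-- The auxiliary function `ϑ^n_{r,s}(α₁, α₂, β₁, β₂)`; the sum over `h` runs from `0` to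
`n - s + r`. -/
def vartheta (n : ℕ) (r s : ℤ) (α₁ α₂ β₁ β₂ : ℝ) : ℝ :=
  (4 * α₂ * β₂ / (α₁ + α₂ - β₁ - β₂) ^ 2) ^ (s - r) *
    ∑ h ∈ Finset.range ((n : ℤ) - s + r + 1).toNat,
      binom n (h + s - r) * (4 * α₁ * β₂ / (α₁ + α₂ - β₁ - β₂) ^ 2) ^ h *
        ∑ l ∈ Finset.range (h + 1),
          binom (h + s - r) l * binom (h + s - r) ((h : ℤ) - l) *
            (α₂ * β₁ / (α₁ * β₂)) ^ l

/-- The auxiliary function `η^n_{r,s}(α₁, α₂, β₁, β₂)`; the sum over `l` runs from `0` to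
`n - s + r`. -/
def eta (n : ℕ) (r s : ℤ) (α₁ α₂ β₁ β₂ : ℝ) : ℝ :=
  (α₂ / α₁) ^ (s - r) * (α₁ * β₂) ^ n *
    ∑ l ∈ Finset.range ((n : ℤ) - s + r + 1).toNat,
      binom n l * binom n (s - r + l) * (α₂ * β₁ / (α₁ * β₂)) ^ l

/-- The series `∑_{n = |m|}^{∞} f(n)` converges with sum `S`. -/
def HasSumFrom (m : ℤ) (f : ℕ → ℝ) (S : ℝ) : Prop :=
  HasSum (fun n : Set.Ici m.natAbs => f n) S

end AlternatingChain

end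

/-! Write the generator as `L - σ`, where `L` hops to a neighbour with the given rates and
multiplies by `δ` at even sites and by `-δ` at odd ones. The backward equation makes `e^{σt}
p_{k,z}(t)`, as a function of `k`, a solution of `u' = L u` starting from the indicator of `z`.
Since `L` is bounded in the sup norm and the probabilities are bounded, the Taylor series converges
to the solution: `e^{σt} p_{k,z}(t) = ∑ tⁱ/i! (Lⁱ 1_z)(k)` (`hasSum_taylor`,
`IsMarkovChain.hasSum_stateProb`). Only a right derivative and continuity are needed; both come from
finite truncations of Chapman-Kolmogorov.

The powers of `L` are explicit because hopping exchanges the parities and so anticommutes with the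
sign `±δ`. With `S` the unit translation, `L² = (α₁S² + α₂)(β₁ + β₂S⁻²) + δ²` on both parities
(`genOp_sq`). Hence `L^{2n}` is a binomial sum of Laurent polynomials in `S²`, whose coefficients
are `η` when `δ = 0` (`mul_eta_eq`) and `ϑ` otherwise (`mul_vartheta_eq`), up to the powers of `q`
and `δ`. Odd powers apply `L` once to `1_z` and then `L^{2n}`. -/

namespace AlternatingChain

/-! ### Taylor series of a bounded linear evolution -/

/-- Multiplication by `C` bounds the sup norm of `L f` in terms of that of `f`. -/
def SupBounded (L : Module.End ℝ (ℤ → ℝ)) (C : ℝ) : Prop :=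
  ∀ (M : ℝ) (f : ℤ → ℝ), (∀ k, |f k| ≤ M) → ∀ k, |L f k| ≤ C * M

theorem SupBounded.pow_apply_le {L : Module.End ℝ (ℤ → ℝ)} {C : ℝ} (hL : SupBounded L C)
    {M : ℝ} {f : ℤ → ℝ} (hf : ∀ k, |f k| ≤ M) (j : ℕ) : ∀ k, |(L ^ j) f k| ≤ C ^ j * M := by
  induction j with
  | zero => simpa using hf
  | succ j ih =>
    intro k
    rw [pow_succ', Module.End.mul_apply, pow_succ', mul_assoc]
    exact hL _ _ ih k

theorem hasDerivAt_pow_div_factorial (i : ℕ) (t : ℝ) :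
    HasDerivAt (fun t : ℝ => t ^ (i + 1) / (i + 1).factorial) (t ^ i / i.factorial) t := by
  have h : t ^ i / i.factorial = ((i + 1 : ℕ) : ℝ) * t ^ (i + 1 - 1) / (i + 1).factorial := by
    rw [Nat.factorial_succ, Nat.add_sub_cancel]
    push_cast
    field_simp
  rw [h]
  exact (hasDerivAt_pow (i + 1) t).div_const ((i + 1).factorial : ℝ)

theorem hasDerivAt_expPartialSum (a : ℕ → ℝ) (j : ℕ) (t : ℝ) :
    HasDerivAt (fun t : ℝ => ∑ i ∈ Finset.range (j + 1), t ^ i / i.factorial * a i)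
      (∑ i ∈ Finset.range j, t ^ i / i.factorial * a (i + 1)) t := by
  simp only [Finset.sum_range_succ']
  simp only [pow_zero]
  exact (HasDerivAt.fun_sum fun i _ => (hasDerivAt_pow_div_factorial i t).mul_const _).add_const _

section Taylor

variable {L : Module.End ℝ (ℤ → ℝ)} {C M T : ℝ} {u : ℤ → ℝ → ℝ}

/-- The right derivative of remainder `j + 1` is `L` applied to remainder `j`, so the bound gains a
factor `C` and is integrated once by the mean value inequality. The induction must be uniform in
`k`, because `L` mixes sites. -/
theorem taylor_remainder_le (hL : SupBounded L C)
    (hcont : ∀ k, ContinuousOn (u k) (Set.Icc 0 T))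
    (hderiv : ∀ k, ∀ t ∈ Set.Ico 0 T,
      HasDerivWithinAt (u k) (L (fun m => u m t) k) (Set.Ici t) t)
    (hbound : ∀ k, ∀ t ∈ Set.Icc 0 T, |u k t| ≤ M) (j : ℕ) :
    ∀ k, ∀ t ∈ Set.Icc 0 T,
      |u k t - ∑ i ∈ Finset.range j, t ^ i / i.factorial * (L ^ i) (fun m => u m 0) k| ≤
        M * C ^ j * (t ^ j / j.factorial) := by
  induction j with
  | zero => simpa using hbound
  | succ j ih =>
    intro k t ht
    refine image_norm_le_of_norm_deriv_right_le_deriv_boundary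
      (f := fun t => u k t -
        ∑ i ∈ Finset.range (j + 1), t ^ i / i.factorial * (L ^ i) (fun m => u m 0) k)
      (f' := fun t => L (fun m => u m t) k -
        ∑ i ∈ Finset.range j, t ^ i / i.factorial * (L ^ (i + 1)) (fun m => u m 0) k)
      (B := fun t => M * C ^ (j + 1) * (t ^ (j + 1) / (j + 1).factorial))
      (B' := fun t => M * C ^ (j + 1) * (t ^ j / j.factorial)) (a := 0) (b := T)
      ?_ ?_ ?_ ?_ ?_ ht
    · exact (hcont k).sub (by fun_prop)
    · intro t ht
      exact (hderiv k t ht).sub (hasDerivAt_expPartialSum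
        (fun i => (L ^ i) (fun m => u m 0) k) j t).hasDerivWithinAt
    · simp [Finset.sum_range_succ']
    · intro t
      exact (hasDerivAt_pow_div_factorial j t).const_mul _
    · intro t ht
      have h := hL _ (fun m => u m t -
        ∑ i ∈ Finset.range j, t ^ i / i.factorial * (L ^ i) (fun m => u m 0) m)
        (fun m => ih m t ⟨ht.1, ht.2.le⟩) k
      have h2 : (fun m => u m t -
          ∑ i ∈ Finset.range j, t ^ i / i.factorial * (L ^ i) (fun m => u m 0) m) =
          (fun m => u m t) -
            ∑ i ∈ Finset.range j, (t ^ i / i.factorial : ℝ) • (L ^ i) (fun m => u m 0) := by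
        ext m
        simp [Finset.sum_apply]
      rw [h2, map_sub, map_sum] at h
      simp only [map_smul, Pi.sub_apply, Finset.sum_apply, Pi.smul_apply, smul_eq_mul] at h
      simp only [Real.norm_eq_abs, pow_succ' L, Module.End.mul_apply]
      refine h.trans_eq (by ring)

theorem summable_pow_div_factorial_mul (t : ℝ) {a : ℕ → ℝ} {K : ℝ}
    (ha : ∀ i, |a i| ≤ C ^ i * K) : Summable fun i : ℕ => t ^ i / i.factorial * a i := by
  refine Summable.of_norm_bounded
    (g := fun i => (|t| * C) ^ i / i.factorial * K)
    ((Real.summable_pow_div_factorial (|t| * C)).mul_right K) fun i => ?_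
  rw [norm_mul, norm_div, norm_pow, Real.norm_eq_abs, Real.norm_eq_abs, Real.norm_eq_abs,
    Nat.abs_cast]
  calc |t| ^ i / i.factorial * |a i| ≤ |t| ^ i / i.factorial * (C ^ i * K) := by
        gcongr; exact ha i
    _ = _ := by rw [mul_pow]; ring

theorem hasSum_taylor (hT : 0 ≤ T) (hL : SupBounded L C)
    (hcont : ∀ k, ContinuousOn (u k) (Set.Icc 0 T))
    (hderiv : ∀ k, ∀ t ∈ Set.Ico 0 T,
      HasDerivWithinAt (u k) (L (fun m => u m t) k) (Set.Ici t) t)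
    (hbound : ∀ k, ∀ t ∈ Set.Icc 0 T, |u k t| ≤ M) (k : ℤ) :
    HasSum (fun i : ℕ => T ^ i / i.factorial * (L ^ i) (fun m => u m 0) k) (u k T) := by
  have hs : Summable fun i : ℕ => T ^ i / i.factorial * (L ^ i) (fun m => u m 0) k :=
    summable_pow_div_factorial_mul T (fun i =>
      hL.pow_apply_le (fun m => hbound m 0 ⟨le_rfl, hT⟩) i k)
  rw [hs.hasSum_iff_tendsto_nat]
  have hz : Tendsto (fun j : ℕ => M * ((C * T) ^ j / j.factorial)) atTop (𝓝 0) := by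
    simpa using (FloorSemiring.tendsto_pow_div_factorial_atTop (C * T)).const_mul M
  rw [tendsto_iff_norm_sub_tendsto_zero]
  refine squeeze_zero (fun _ => norm_nonneg _) (fun j => ?_) hz
  rw [norm_sub_rev]
  refine (taylor_remainder_le hL hcont hderiv hbound j k T ⟨hT, le_rfl⟩).trans_eq ?_
  rw [mul_pow]; ring

end Taylor
end AlternatingChain

/-! ### Continuity of the state probabilities and the backward equation -/

namespace AlternatingChain
section Chain

variable {Ω : Type*} [MeasurableSpace Ω] {P : ℤ → Measure Ω} {X : ℝ≥0 → Ω → ℤ}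

theorem stateProb_nonneg (k n : ℤ) (t : ℝ≥0) : 0 ≤ stateProb P X k n t := measureReal_nonneg

namespace IsMarkovChain

theorem stateProb_le_one (hX : IsMarkovChain P X) (k n : ℤ) (t : ℝ≥0) :
    stateProb P X k n t ≤ 1 :=
  have := hX.isProb k
  measureReal_le_one

theorem measurableSet_preimage (hX : IsMarkovChain P X) (t : ℝ≥0) (s : Set ℤ) :
    MeasurableSet (X t ⁻¹' s) :=
  hX.measurable t (MeasurableSet.of_discrete)

theorem measureReal_preimage_finset (hX : IsMarkovChain P X) (k : ℤ) (t : ℝ≥0) (F : Finset ℤ) :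
    (P k).real (X t ⁻¹' F) = ∑ m ∈ F, stateProb P X k m t := by
  have := hX.isProb k
  rw [← Set.biUnion_preimage_singleton]
  refine measureReal_biUnion_finset (fun i _ j _ hij => ?_)
    (fun m _ => hX.measurableSet_preimage t {m})
  exact Disjoint.preimage _ (Set.disjoint_singleton.2 hij)

theorem stateProb_zero (hX : IsMarkovChain P X) (k n : ℤ) :
    stateProb P X k n 0 = if n = k then 1 else 0 := by
  have := hX.isProb k
  have hk : stateProb P X k k 0 = 1 := by simp [stateProb, Measure.real, hX.start k]
  split_ifs with h
  · rw [h, hk]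
  · have h2 : (P k).real (X 0 ⁻¹' ({k, n} : Finset ℤ)) ≤ 1 := measureReal_le_one
    rw [hX.measureReal_preimage_finset, Finset.sum_pair (Ne.symm h), hk] at h2
    linarith [stateProb_nonneg (P := P) (X := X) k n 0]

theorem measureReal_inter (hX : IsMarkovChain P X) (k m n : ℤ) (h t : ℝ≥0) :
    (P k).real (X h ⁻¹' {m} ∩ X (h + t) ⁻¹' {n}) =
      stateProb P X k m h * stateProb P X m n t := by
  have := hX.markov k h t m n Set.univ MeasurableSet.univ
  simp only [Set.univ_inter] at this
  simp [stateProb, Measure.real, this]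

theorem measureReal_inter_finset (hX : IsMarkovChain P X) (k n : ℤ) (h t : ℝ≥0) (F : Finset ℤ) :
    (P k).real (X (h + t) ⁻¹' {n} ∩ X h ⁻¹' F) =
      ∑ m ∈ F, stateProb P X k m h * stateProb P X m n t := by
  have := hX.isProb k
  rw [← Set.biUnion_preimage_singleton (X h), Set.inter_comm, Set.iUnion₂_inter]
  simp only [← hX.measureReal_inter]
  refine measureReal_biUnion_finset (fun i _ j _ hij => ?_)
    (fun m _ => (hX.measurableSet_preimage h {m}).inter (hX.measurableSet_preimage _ {n}))
  exact (Disjoint.preimage _ (Set.disjoint_singleton.2 hij)).mono Set.inter_subset_left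
    Set.inter_subset_left

/-- With `stateProb_add_le`, a truncated Chapman-Kolmogorov relation: restricting the intermediate
state to a finite `F` loses at most the probability of being outside `F` at time `h`. -/
theorem sum_le_stateProb_add (hX : IsMarkovChain P X) (k n : ℤ) (h t : ℝ≥0) (F : Finset ℤ) :
    ∑ m ∈ F, stateProb P X k m h * stateProb P X m n t ≤ stateProb P X k n (h + t) := by
  have := hX.isProb k
  rw [← hX.measureReal_inter_finset]
  exact measureReal_mono Set.inter_subset_left

theorem stateProb_add_le (hX : IsMarkovChain P X) (k n : ℤ) (h t : ℝ≥0) (F : Finset ℤ) :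
    stateProb P X k n (h + t) ≤
      ∑ m ∈ F, stateProb P X k m h * stateProb P X m n t +
        (1 - ∑ m ∈ F, stateProb P X k m h) := by
  have := hX.isProb k
  have hF := hX.measurableSet_preimage h (F : Set ℤ)
  rw [← hX.measureReal_inter_finset, ← hX.measureReal_preimage_finset, ← probReal_compl_eq_one_sub hF,
    stateProb, ← measureReal_inter_add_sdiff (s := X (h + t) ⁻¹' {n}) hF]
  gcongr
  · finiteness
  · intro x hx
    exact hx.2

/-- Truncation at `F = {k}`. The bound does not depend on `t`, so it serves as a modulus of
continuity on both sides. -/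
theorem abs_stateProb_add_sub_le (hX : IsMarkovChain P X) (k n : ℤ) (h t : ℝ≥0) :
    |stateProb P X k n (h + t) - stateProb P X k n t| ≤ 1 - stateProb P X k k h := by
  have h1 := hX.sum_le_stateProb_add k n h t {k}
  have h2 := hX.stateProb_add_le k n h t {k}
  simp only [Finset.sum_singleton] at h1 h2
  have h3 := stateProb_nonneg (P := P) (X := X) k n t
  have h4 := hX.stateProb_le_one k n t
  have h5 := hX.stateProb_le_one k k h
  rw [abs_le]
  constructor <;> nlinarith

variable {G : ℤ → ℤ → ℝ}

theorem tendsto_stateProb_self (hX : IsMarkovChain P X) (hG : HasGenerator P X G) (k : ℤ) :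
    Tendsto (stateProb P X k k) (𝓝 0) (𝓝 1) := by
  have h0 : stateProb P X k k 0 = 1 := by simp [hX.stateProb_zero]
  have h1 : Tendsto (fun t : ℝ≥0 => (t : ℝ)) (𝓝[>] 0) (𝓝 0) :=
    (NNReal.continuous_coe.tendsto' 0 0 (by simp)).mono_left nhdsWithin_le_nhds
  have h2 := ((hG k k).mul h1).add_const 1
  rw [mul_zero, zero_add] at h2
  have h3 : Tendsto (stateProb P X k k) (𝓝[>] 0) (𝓝 1) := by
    refine h2.congr' ?_
    filter_upwards [self_mem_nhdsWithin] with t ht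
    have : (t : ℝ) ≠ 0 := by simpa using (ne_of_gt ht : t ≠ 0)
    rw [div_mul_cancel₀ _ this, h0]
    ring
  -- The generator controls only `t > 0`; in `ℝ≥0` the point `0` itself is all that is missing from
  -- a neighbourhood.
  have h4 : 𝓝 (0 : ℝ≥0) = pure 0 ⊔ 𝓝[>] 0 := by
    rw [← nhdsWithin_insert, Set.Ioi_insert, ← bot_eq_zero, Set.Ici_bot, nhdsWithin_univ]
  rw [h4]
  refine Tendsto.sup ?_ h3
  rw [← h0]
  exact tendsto_pure_nhds _ _

theorem continuous_stateProb (hX : IsMarkovChain P X) (hG : HasGenerator P X G) (k n : ℤ) :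
    Continuous (stateProb P X k n) := by
  -- Subtraction is truncated, so `(y - x) + (x - y)` is the distance between `x` and `y`.
  have key : ∀ x y : ℝ≥0, |stateProb P X k n y - stateProb P X k n x| ≤
      1 - stateProb P X k k ((y - x) + (x - y)) := by
    intro x y
    rcases le_total x y with h | h
    · have := hX.abs_stateProb_add_sub_le k n (y - x) x
      rwa [tsub_add_cancel_of_le h, ← add_zero (y - x), ← tsub_eq_zero_of_le h] at this
    · have := hX.abs_stateProb_add_sub_le k n (x - y) y
      rwa [tsub_add_cancel_of_le h, ← zero_add (x - y), ← tsub_eq_zero_of_le h, abs_sub_comm] at this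
  rw [continuous_iff_continuousAt]
  intro x
  rw [ContinuousAt, tendsto_iff_norm_sub_tendsto_zero]
  refine squeeze_zero (fun _ => norm_nonneg _) (fun y => key x y) ?_
  have h1 : Tendsto (fun y : ℝ≥0 => (y - x) + (x - y)) (𝓝 x) (𝓝 0) := by
    have : Continuous fun y : ℝ≥0 => (y - x) + (x - y) := by fun_prop
    exact this.tendsto' _ _ (by simp)
  have h2 := ((hX.tendsto_stateProb_self hG k).comp h1).const_sub 1
  simpa using h2

/-- The backward equation, with right difference quotients, for a conservative row of the
generator. -/
theorem tendsto_backward (hX : IsMarkovChain P X) (hG : HasGenerator P X G) (k n : ℤ)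
    {F : Finset ℤ} (hk : k ∈ F) (hF : ∑ m ∈ F, G k m = 0) (t : ℝ≥0) :
    Tendsto (fun h : ℝ≥0 => (stateProb P X k n (h + t) - stateProb P X k n t) / (h : ℝ))
      (𝓝[>] 0) (𝓝 (∑ m ∈ F, G k m * stateProb P X m n t)) := by
  have h1 : Tendsto (fun h : ℝ≥0 => ∑ m ∈ F,
      (stateProb P X k m h - stateProb P X k m 0) / (h : ℝ) * stateProb P X m n t) (𝓝[>] 0)
      (𝓝 (∑ m ∈ F, G k m * stateProb P X m n t)) :=
    tendsto_finsetSum _ fun m _ => (hG k m).mul_const _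
  have h2 : Tendsto (fun h : ℝ≥0 => ∑ m ∈ F,
      (stateProb P X k m h - stateProb P X k m 0) / (h : ℝ)) (𝓝[>] 0) (𝓝 0) := by
    rw [← hF]
    exact tendsto_finsetSum _ fun m _ => hG k m
  have h3 := h1.sub h2
  rw [sub_zero] at h3
  have e1 : ∑ m ∈ F, stateProb P X k m 0 * stateProb P X m n t = stateProb P X k n t := by
    simp [hX.stateProb_zero, hk]
  have e2 : ∑ m ∈ F, stateProb P X k m 0 = 1 := by
    simp [hX.stateProb_zero, hk]
  -- The two truncated bounds differ by the rate of escape from `F`, which tends to `0` since the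
  -- row of the generator sums to zero over `F`.
  refine tendsto_of_tendsto_of_tendsto_of_le_of_le h1 h3 (fun h => ?_) (fun h => ?_)
  · have := hX.sum_le_stateProb_add k n h t F
    simp only [div_mul_eq_mul_div, ← Finset.sum_div, sub_mul, Finset.sum_sub_distrib, e1]
    gcongr
  · have := hX.stateProb_add_le k n h t F
    simp only [div_mul_eq_mul_div, ← Finset.sum_div, sub_mul, Finset.sum_sub_distrib, e1, e2,
      ← sub_div]
    refine div_le_div_of_nonneg_right ?_ h.2
    linarith

theorem hasDerivWithinAt_stateProb (hX : IsMarkovChain P X) (hG : HasGenerator P X G) (k n : ℤ)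
    {F : Finset ℤ} (hk : k ∈ F) (hF : ∑ m ∈ F, G k m = 0) {t : ℝ} (ht : 0 ≤ t) :
    HasDerivWithinAt (fun x : ℝ => stateProb P X k n x.toNNReal)
      (∑ m ∈ F, G k m * stateProb P X m n t.toNNReal) (Set.Ici t) t := by
  rw [hasDerivWithinAt_iff_tendsto_slope, Set.Ici_sdiff_left]
  have h1 : Tendsto (fun y : ℝ => (y - t).toNNReal) (𝓝[>] t) (𝓝[>] 0) := by
    refine tendsto_nhdsWithin_iff.2 ⟨?_, ?_⟩
    · have : Continuous fun y : ℝ => (y - t).toNNReal := by fun_prop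
      exact (this.tendsto' _ _ (by simp)).mono_left nhdsWithin_le_nhds
    · filter_upwards [self_mem_nhdsWithin] with y hy
      simpa using hy
  refine ((hX.tendsto_backward hG k n hk hF t.toNNReal).comp h1).congr' ?_
  filter_upwards [self_mem_nhdsWithin] with y hy
  have hy' : 0 ≤ y - t := sub_nonneg.2 (le_of_lt hy)
  simp only [Function.comp_apply, slope_def_field, Real.coe_toNNReal _ hy',
    ← Real.toNNReal_add hy' ht, sub_add_cancel]

end IsMarkovChain
end Chain
end AlternatingChain

/-! ### Powers of the operator `L` -/

noncomputable section
namespace AlternatingChain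

/-- Translation of functions on `ℤ`. -/
def shift (z : ℤ) : Module.End ℝ (ℤ → ℝ) := LinearMap.funLeft ℝ ℝ (· + z)

theorem shift_apply (z : ℤ) (f : ℤ → ℝ) (k : ℤ) : shift z f k = f (k + z) := rfl

theorem shift_zero : shift 0 = 1 := by
  ext; simp [shift_apply]

theorem shift_mul (y z : ℤ) : shift y * shift z = shift (y + z) := by
  refine LinearMap.ext fun f => funext fun k => ?_
  simp only [Module.End.mul_apply, shift_apply, add_assoc]

theorem shift_commute (y z : ℤ) : Commute (shift y) (shift z) := by
  rw [Commute, SemiconjBy, shift_mul, shift_mul, add_comm]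

theorem shift_pow (z : ℤ) (n : ℕ) : shift z ^ n = shift (n * z) := by
  induction n with
  | zero => simp [shift_zero]
  | succ n ih => rw [pow_succ, ih, shift_mul]; push_cast; ring_nf

/-- The off-diagonal part of the generator plus `δ` on even and `-δ` on odd sites. -/
def genOp (a₁ a₂ b₁ b₂ δ : ℝ) : Module.End ℝ (ℤ → ℝ) where
  toFun f k := if Even k then δ * f k + a₁ * f (k + 1) + a₂ * f (k - 1)
    else -δ * f k + b₁ * f (k + 1) + b₂ * f (k - 1)
  map_add' f g := by ext k; simp only [Pi.add_apply]; split_ifs <;> ring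
  map_smul' c f := by
    ext k; simp only [Pi.smul_apply, smul_eq_mul, RingHom.id_apply]; split_ifs <;> ring

theorem genOp_apply (a₁ a₂ b₁ b₂ δ : ℝ) (f : ℤ → ℝ) (k : ℤ) :
    genOp a₁ a₂ b₁ b₂ δ f k = if Even k then δ * f k + a₁ * f (k + 1) + a₂ * f (k - 1)
      else -δ * f k + b₁ * f (k + 1) + b₂ * f (k - 1) := rfl

theorem genOp_supBounded {a₁ a₂ b₁ b₂ : ℝ} (ha₁ : 0 ≤ a₁) (ha₂ : 0 ≤ a₂) (hb₁ : 0 ≤ b₁)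
    (hb₂ : 0 ≤ b₂) (δ : ℝ) :
    SupBounded (genOp a₁ a₂ b₁ b₂ δ) (1 + |δ| + a₁ + a₂ + b₁ + b₂) := by
  intro M f hf k
  have hM : 0 ≤ M := (abs_nonneg _).trans (hf 0)
  have key : ∀ c p q : ℝ, |c| = |δ| → 0 ≤ p → 0 ≤ q →
      |c * f k + p * f (k + 1) + q * f (k - 1)| ≤ (|δ| + p + q) * M := by
    intro c p q hc hp hq
    refine (abs_add_three _ _ _).trans ?_
    rw [abs_mul, abs_mul, abs_mul, hc, abs_of_nonneg hp, abs_of_nonneg hq, add_mul, add_mul]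
    gcongr <;> exact hf _
  rw [genOp_apply]
  split_ifs
  · refine (key δ a₁ a₂ rfl ha₁ ha₂).trans ?_
    exact mul_le_mul_of_nonneg_right (by linarith) hM
  · refine (key (-δ) b₁ b₂ (abs_neg δ) hb₁ hb₂).trans ?_
    exact mul_le_mul_of_nonneg_right (by linarith) hM

/-- The factorised square of the off-diagonal part of `genOp`. -/
def hopSq (a₁ a₂ b₁ b₂ : ℝ) : Module.End ℝ (ℤ → ℝ) :=
  (a₁ • shift 2 + a₂ • 1) * (b₁ • 1 + b₂ • shift (-2))

theorem hopSq_swap (a₁ a₂ b₁ b₂ : ℝ) : hopSq b₁ b₂ a₁ a₂ = hopSq a₁ a₂ b₁ b₂ := by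
  refine LinearMap.ext fun f => funext fun k => ?_
  simp only [hopSq, Module.End.mul_apply, LinearMap.add_apply, LinearMap.smul_apply,
    Module.End.one_apply, Pi.add_apply, Pi.smul_apply, smul_eq_mul, shift_apply]
  ring_nf

/-- The cross terms cancel because a hop flips the sign of `±δ`. Two hops give `a₁b₁S² + a₁b₂ + a₂b₁
+ a₂b₂S⁻²` from either parity, which factors. -/
theorem genOp_sq (a₁ a₂ b₁ b₂ δ : ℝ) :
    genOp a₁ a₂ b₁ b₂ δ ^ 2 = hopSq a₁ a₂ b₁ b₂ + (δ ^ 2) • 1 := by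
  refine LinearMap.ext fun f => funext fun k => ?_
  have e1 : k + 1 + 1 = k + 2 := by ring
  have e2 : k + 1 - 1 = k := by ring
  have e3 : k - 1 + 1 = k := by ring
  have e4 : k - 1 - 1 = k + -2 := by ring
  have e5 : k + 2 + -2 = k := by ring
  simp only [hopSq, sq (genOp _ _ _ _ _), Module.End.mul_apply, LinearMap.add_apply,
    LinearMap.smul_apply, Module.End.one_apply, Pi.add_apply, Pi.smul_apply, smul_eq_mul,
    shift_apply, genOp_apply, Int.even_add_one, Int.even_sub_one, e1, e2, e3, e4, e5]
  by_cases hk : Even k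
  · simp only [hk, not_true_eq_false, if_true, if_false]; ring
  · simp only [hk, not_false_eq_true, if_true, if_false]; ring

/-- The coefficient of `x ^ m` in `(a₁ x + a₂) ^ n * (b₁ + b₂ x⁻¹) ^ n`. -/
def stepCoeff (a₁ a₂ b₁ b₂ : ℝ) (n : ℕ) (m : ℤ) : ℝ :=
  ∑ l ∈ Finset.range (n + 1), (n.choose l) * a₁ ^ (n - l) * a₂ ^ l *
    if 0 ≤ m + l then (n.choose (m + l).toNat) * b₁ ^ (m + l).toNat * b₂ ^ (n - (m + l).toNat)
    else 0

theorem shiftFactor_pow (a₁ a₂ : ℝ) (n : ℕ) : (a₁ • shift 2 + a₂ • 1) ^ n =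
    ∑ l ∈ Finset.range (n + 1), (n.choose l * a₁ ^ (n - l) * a₂ ^ l : ℝ) •
      shift (2 * ((n : ℤ) - l)) := by
  rw [add_comm, Commute.add_pow
    (((Commute.one_left (shift 2)).smul_left a₂).smul_right a₁)]
  refine Finset.sum_congr rfl fun l hl => ?_
  have hl' : l ≤ n := Nat.lt_succ_iff.1 (Finset.mem_range.1 hl)
  rw [smul_pow, smul_pow, one_pow, shift_pow, Nat.cast_sub hl', smul_mul_smul_comm, one_mul,
    mul_comm ((n : ℤ) - l), ← nsmul_eq_mul', ← Nat.cast_smul_eq_nsmul ℝ, smul_smul]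
  congr 1
  ring

theorem shiftFactor_neg_pow (b₁ b₂ : ℝ) (n : ℕ) : (b₁ • 1 + b₂ • shift (-2)) ^ n =
    ∑ j ∈ Finset.range (n + 1), (n.choose j * b₁ ^ j * b₂ ^ (n - j) : ℝ) •
      shift (-2 * ((n : ℤ) - j)) := by
  rw [Commute.add_pow
    (((Commute.one_left (shift (-2))).smul_left b₁).smul_right b₂)]
  refine Finset.sum_congr rfl fun l hl => ?_
  have hl' : l ≤ n := Nat.lt_succ_iff.1 (Finset.mem_range.1 hl)
  rw [smul_pow, smul_pow, one_pow, shift_pow, Nat.cast_sub hl', smul_mul_smul_comm, one_mul,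
    mul_comm ((n : ℤ) - l), ← nsmul_eq_mul', ← Nat.cast_smul_eq_nsmul ℝ, smul_smul]
  congr 1
  ring

theorem hopSq_pow (a₁ a₂ b₁ b₂ : ℝ) (n : ℕ) : hopSq a₁ a₂ b₁ b₂ ^ n =
    (a₁ • shift 2 + a₂ • 1) ^ n * (b₁ • 1 + b₂ • shift (-2)) ^ n := by
  refine Commute.mul_pow ?_ n
  refine Commute.add_left ?_ ?_ <;> refine Commute.add_right ?_ ?_ <;>
    refine Commute.smul_left (Commute.smul_right ?_ _) _
  · exact Commute.one_right _
  · exact shift_commute _ _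
  · exact Commute.one_right _
  · exact Commute.one_left _

theorem hopSq_pow_single_apply (a₁ a₂ b₁ b₂ : ℝ) (n : ℕ) (k z : ℤ) :
    (hopSq a₁ a₂ b₁ b₂ ^ n) (Pi.single z 1) k =
      ∑ l ∈ Finset.range (n + 1), ∑ j ∈ Finset.range (n + 1),
        (n.choose l * a₁ ^ (n - l) * a₂ ^ l) * ((n.choose j * b₁ ^ j * b₂ ^ (n - j)) *
          if k + 2 * ((j : ℤ) - l) = z then 1 else 0) := by
  rw [hopSq_pow, shiftFactor_pow, shiftFactor_neg_pow, Finset.sum_mul_sum]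
  simp only [LinearMap.sum_apply, Finset.sum_apply]
  refine Finset.sum_congr rfl fun l _ => Finset.sum_congr rfl fun j _ => ?_
  rw [smul_mul_smul_comm, shift_mul, LinearMap.smul_apply, Pi.smul_apply, shift_apply,
    smul_eq_mul, Pi.single_apply, mul_assoc]
  congr 3
  ring_nf

/-- Evaluating at `k` on the indicator of `k + 2m` reads off the coefficient of `S^{2m}`; for each
`l` only `j = m + l` contributes. -/
theorem hopSq_pow_single (a₁ a₂ b₁ b₂ : ℝ) (n : ℕ) (k m : ℤ) :
    (hopSq a₁ a₂ b₁ b₂ ^ n) (Pi.single (k + 2 * m) 1) k = stepCoeff a₁ a₂ b₁ b₂ n m := by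
  rw [hopSq_pow_single_apply, stepCoeff]
  refine Finset.sum_congr rfl fun l _ => ?_
  rw [← Finset.mul_sum]
  congr 1
  split_ifs with h
  · obtain ⟨j, hj⟩ := Int.eq_ofNat_of_zero_le h
    rw [hj, Int.toNat_natCast, Finset.sum_eq_single j]
    · rw [if_pos (by omega), mul_one]
    · intro i _ hi
      rw [if_neg (by omega), mul_zero]
    · intro hn
      rw [Nat.choose_eq_zero_of_lt (by simpa using hn)]
      simp
  · refine Finset.sum_eq_zero fun j _ => ?_
    rw [if_neg (by omega), mul_zero]

theorem hopSq_pow_single_of_odd (a₁ a₂ b₁ b₂ : ℝ) (n : ℕ) {k z : ℤ} (h : ¬ Even (z - k)) :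
    (hopSq a₁ a₂ b₁ b₂ ^ n) (Pi.single z 1) k = 0 := by
  rw [hopSq_pow_single_apply]
  refine Finset.sum_eq_zero fun l _ => Finset.sum_eq_zero fun j _ => ?_
  rw [if_neg, mul_zero, mul_zero]
  rintro rfl
  exact h ⟨(j : ℤ) - l, by ring⟩

/-- The entries of the even powers of `genOp` between sites at distance `2 m`. -/
def evenCoeff (a₁ a₂ b₁ b₂ δ : ℝ) (n : ℕ) (m : ℤ) : ℝ :=
  ∑ k ∈ Finset.range (n + 1), n.choose k * (δ ^ 2) ^ (n - k) * stepCoeff a₁ a₂ b₁ b₂ k m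

theorem genOp_pow_two_mul (a₁ a₂ b₁ b₂ δ : ℝ) (n : ℕ) : genOp a₁ a₂ b₁ b₂ δ ^ (2 * n) =
    ∑ k ∈ Finset.range (n + 1), (n.choose k * (δ ^ 2) ^ (n - k) : ℝ) •
      hopSq a₁ a₂ b₁ b₂ ^ k := by
  rw [pow_mul, genOp_sq, Commute.add_pow ((Commute.one_right _).smul_right _)]
  refine Finset.sum_congr rfl fun k _ => ?_
  rw [smul_pow, one_pow, mul_smul_comm, mul_one, ← nsmul_eq_mul', ← Nat.cast_smul_eq_nsmul ℝ,
    smul_smul]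

theorem genOp_pow_two_mul_single (a₁ a₂ b₁ b₂ δ : ℝ) (n : ℕ) (k m : ℤ) :
    (genOp a₁ a₂ b₁ b₂ δ ^ (2 * n)) (Pi.single (k + 2 * m) 1) k =
      evenCoeff a₁ a₂ b₁ b₂ δ n m := by
  rw [genOp_pow_two_mul, evenCoeff]
  simp only [LinearMap.sum_apply, Finset.sum_apply, LinearMap.smul_apply, Pi.smul_apply,
    smul_eq_mul, hopSq_pow_single]

theorem genOp_pow_two_mul_single_of_odd (a₁ a₂ b₁ b₂ δ : ℝ) (n : ℕ) {k z : ℤ}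
    (h : ¬ Even (z - k)) :
    (genOp a₁ a₂ b₁ b₂ δ ^ (2 * n)) (Pi.single z 1) k = 0 := by
  rw [genOp_pow_two_mul]
  simp only [LinearMap.sum_apply, Finset.sum_apply, LinearMap.smul_apply, Pi.smul_apply,
    smul_eq_mul, hopSq_pow_single_of_odd _ _ _ _ _ h, mul_zero, Finset.sum_const_zero]

theorem stepCoeff_swap (a₁ a₂ b₁ b₂ : ℝ) (n : ℕ) (m : ℤ) :
    stepCoeff b₁ b₂ a₁ a₂ n m = stepCoeff a₁ a₂ b₁ b₂ n m := by
  rw [← hopSq_pow_single _ _ _ _ n 0, ← hopSq_pow_single _ _ _ _ n 0, hopSq_swap]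

theorem evenCoeff_swap (a₁ a₂ b₁ b₂ δ : ℝ) (n : ℕ) (m : ℤ) :
    evenCoeff b₁ b₂ a₁ a₂ δ n m = evenCoeff a₁ a₂ b₁ b₂ δ n m := by
  simp only [evenCoeff, stepCoeff_swap]

/-- The Laurent polynomial has exponents between `-n` and `n`. This is why the series may start at
`|m|`. -/
theorem stepCoeff_eq_zero (a₁ a₂ b₁ b₂ : ℝ) {n : ℕ} {m : ℤ} (h : n < m.natAbs) :
    stepCoeff a₁ a₂ b₁ b₂ n m = 0 := by
  refine Finset.sum_eq_zero fun l hl => ?_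
  have hl' : l ≤ n := Nat.lt_succ_iff.1 (Finset.mem_range.1 hl)
  split_ifs with hm
  · rw [Nat.choose_eq_zero_of_lt (by omega : n < (m + l).toNat)]
    simp
  · simp

theorem evenCoeff_eq_zero (a₁ a₂ b₁ b₂ δ : ℝ) {n : ℕ} {m : ℤ} (h : n < m.natAbs) :
    evenCoeff a₁ a₂ b₁ b₂ δ n m = 0 := by
  refine Finset.sum_eq_zero fun k hk => ?_
  have hk' : k ≤ n := Nat.lt_succ_iff.1 (Finset.mem_range.1 hk)
  rw [stepCoeff_eq_zero _ _ _ _ (by omega), mul_zero]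

/-- A column of `L`: the neighbours from which `z` is entered have the opposite parity, so the rates
are those of the other class. -/
theorem genOp_single_even (a₁ a₂ b₁ b₂ δ : ℝ) {z : ℤ} (hz : Even z) :
    genOp a₁ a₂ b₁ b₂ δ (Pi.single z 1) =
      δ • Pi.single z 1 + b₁ • Pi.single (z - 1) 1 + b₂ • Pi.single (z + 1) 1 := by
  ext k
  obtain ⟨r, rfl⟩ := hz
  simp only [genOp_apply, Pi.single_apply, Pi.add_apply, Pi.smul_apply, smul_eq_mul, Int.even_iff]
  split_ifs <;> first | omega | simp

theorem genOp_single_odd (a₁ a₂ b₁ b₂ δ : ℝ) {z : ℤ} (hz : ¬ Even z) :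
    genOp a₁ a₂ b₁ b₂ δ (Pi.single z 1) =
      (-δ) • Pi.single z 1 + a₁ • Pi.single (z - 1) 1 + a₂ • Pi.single (z + 1) 1 := by
  ext k
  rw [Int.even_iff] at hz
  simp only [genOp_apply, Pi.single_apply, Pi.add_apply, Pi.smul_apply, smul_eq_mul, Int.even_iff]
  split_ifs <;> first | omega | simp

end AlternatingChain
end

/-! ### Identification of the coefficients with `η` and `ϑ` -/

noncomputable section
namespace AlternatingChain

theorem binom_natCast (n l : ℕ) : binom n l = n.choose l := by simp [binom]

theorem binom_of_neg_right (a : ℤ) {b : ℤ} (h : b < 0) : binom a b = 0 :=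
  if_neg fun h' => by omega

theorem binom_of_lt (n : ℕ) {b : ℤ} (h : n < b) : binom n b = 0 := by
  obtain ⟨c, rfl⟩ := Int.eq_ofNat_of_zero_le (by omega : 0 ≤ b)
  rw [binom_natCast, Nat.choose_eq_zero_of_lt (by exact_mod_cast h), Nat.cast_zero]

theorem binom_symm (n : ℕ) (b : ℤ) : binom n (n - b) = binom n b := by
  rcases lt_or_ge b 0 with hb | hb
  · rw [binom_of_neg_right _ hb, binom_of_lt _ (by omega)]
  · rcases lt_or_ge (n : ℤ) b with hn | hn
    · rw [binom_of_lt _ hn, binom_of_neg_right _ (by omega)]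
    · obtain ⟨c, rfl⟩ := Int.eq_ofNat_of_zero_le hb
      have hc : c ≤ n := by exact_mod_cast hn
      rw [← Nat.cast_sub hc, binom_natCast, binom_natCast, Nat.choose_symm hc]

theorem sum_binom_range (n : ℕ) (m : ℤ) (x : ℝ) :
    ∑ l ∈ Finset.range ((n : ℤ) - m + 1).toNat, binom n l * binom n (m + l) * x ^ l =
      ∑ l ∈ Finset.range (n + 1), binom n l * binom n (m + l) * x ^ l := by
  set N := ((n : ℤ) - m + 1).toNat with hN
  rw [Finset.sum_subset (Finset.range_mono (le_max_left N (n + 1))),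
    Finset.sum_subset (Finset.range_mono (le_max_right N (n + 1)))]
  · intro l _ hl
    rw [Finset.mem_range, not_lt] at hl
    rw [binom_of_lt n (by omega : (n : ℤ) < l), zero_mul, zero_mul]
  · intro l _ hl
    rw [Finset.mem_range, not_lt] at hl
    rw [binom_of_lt n (by omega : (n : ℤ) < m + l), mul_zero, zero_mul]

section Coefficients

variable {a₁ a₂ b₁ b₂ : ℝ}

/-- Termwise, `a₁^{n-l} a₂^l b₁^{m+l} b₂^{n-m-l} = (b₁/b₂)^m (a₁b₂)^n (a₂b₁/(a₁b₂))^l`. -/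
theorem mul_sum_binom_eq_stepCoeff (ha₁ : 0 < a₁) (ha₂ : 0 < a₂) (hb₁ : 0 < b₁) (hb₂ : 0 < b₂)
    (n : ℕ) (m : ℤ) :
    (b₁ / b₂) ^ m * (a₁ * b₂) ^ n *
      ∑ l ∈ Finset.range ((n : ℤ) - m + 1).toNat,
        binom n l * binom n (m + l) * (a₂ * b₁ / (a₁ * b₂)) ^ l = stepCoeff a₁ a₂ b₁ b₂ n m := by
  rw [sum_binom_range, stepCoeff, Finset.mul_sum]
  refine Finset.sum_congr rfl fun l hl => ?_
  have hl' : l ≤ n := Nat.lt_succ_iff.1 (Finset.mem_range.1 hl)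
  rw [binom_natCast]
  split_ifs with h
  · obtain ⟨j, hj⟩ := Int.eq_ofNat_of_zero_le h
    rw [hj, binom_natCast, Int.toNat_natCast]
    rcases lt_or_ge n j with hn | hn
    · simp [Nat.choose_eq_zero_of_lt hn]
    · obtain rfl : m = (j : ℤ) - l := by omega
      obtain ⟨p, rfl⟩ := Nat.exists_eq_add_of_le hl'
      obtain ⟨p', hp'⟩ := Nat.exists_eq_add_of_le hn
      have e : (a₁ * b₂) ^ (l + p) = a₁ ^ l * a₁ ^ p * (b₂ ^ j * b₂ ^ p') := by
        rw [mul_pow, pow_add, hp', pow_add]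
      have e2 : l + p - j = p' := by omega
      rw [e, e2, Nat.add_sub_cancel_left, zpow_sub₀ (by positivity), zpow_natCast, zpow_natCast,
        div_pow, div_pow, div_pow, mul_pow, mul_pow]
      field_simp
  · rw [binom_of_neg_right _ (by omega)]
    simp

theorem mul_eta_eq (ha₁ : 0 < a₁) (ha₂ : 0 < a₂) (hb₁ : 0 < b₁) (hb₂ : 0 < b₂)
    (n : ℕ) (r s : ℤ) :
    (a₁ * b₁ / (a₂ * b₂)) ^ (s - r) * eta n r s a₁ a₂ b₁ b₂ =
      stepCoeff a₁ a₂ b₁ b₂ n (s - r) := by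
  rw [← mul_sum_binom_eq_stepCoeff ha₁ ha₂ hb₁ hb₂, eta, ← sub_add (n : ℤ), ← mul_assoc,
    ← mul_assoc, ← mul_zpow]
  congr 3
  field_simp

theorem vartheta_inner_eq (h k : ℕ) (m : ℤ) (hk : (h : ℤ) + m = k) (x : ℝ) :
    ∑ l ∈ Finset.range (h + 1), binom k l * binom k ((h : ℤ) - l) * x ^ l =
      ∑ l ∈ Finset.range ((k : ℤ) - m + 1).toNat, binom k l * binom k (m + l) * x ^ l := by
  have e : ((k : ℤ) - m + 1).toNat = h + 1 := by omega
  rw [e]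
  refine Finset.sum_congr rfl fun l _ => ?_
  rw [← binom_symm k (m + l)]
  congr 3
  omega

/-- The substitution `k = h + m` turns the sum over `h` into the binomial expansion of `(hopSq +
δ²)^n`, the inner sum becoming `stepCoeff` of index `k`. Fixing only the square of `a₁ + a₂ - b₁ -
b₂` lets the same `δ` serve after exchanging the two pairs of rates. -/
theorem mul_vartheta_eq (ha₁ : 0 < a₁) (ha₂ : 0 < a₂) (hb₁ : 0 < b₁) (hb₂ : 0 < b₂)
    {δ : ℝ} (hδ : δ ≠ 0) (hδ' : (a₁ + a₂ - b₁ - b₂) ^ 2 = 4 * δ ^ 2) (n : ℕ) (r s : ℤ) :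
    δ ^ (2 * n) * ((a₁ * b₁ / (a₂ * b₂)) ^ (s - r) * vartheta n r s a₁ a₂ b₁ b₂) =
      evenCoeff a₁ a₂ b₁ b₂ δ n (s - r) := by
  obtain ⟨m, rfl⟩ : ∃ m, s = r + m := ⟨s - r, by ring⟩
  have e1 : (n : ℤ) - (r + m) + r + 1 = n - m + 1 := by ring
  have e2 : ∀ h : ℕ, (h : ℤ) + (r + m) - r = h + m := fun h => by ring
  simp only [vartheta, hδ', e1, e2, add_sub_cancel_left]
  rw [← mul_assoc, ← mul_assoc, Finset.mul_sum, evenCoeff]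
  have term : ∀ h k : ℕ, (h : ℤ) + m = k → k ≤ n →
      δ ^ (2 * n) * (a₁ * b₁ / (a₂ * b₂)) ^ m * (4 * a₂ * b₂ / (4 * δ ^ 2)) ^ m *
        (binom n (h + m) * (4 * a₁ * b₂ / (4 * δ ^ 2)) ^ h *
          ∑ l ∈ Finset.range (h + 1), binom (h + m) l * binom (h + m) ((h : ℤ) - l) *
            (a₂ * b₁ / (a₁ * b₂)) ^ l) =
      n.choose k * (δ ^ 2) ^ (n - k) * stepCoeff a₁ a₂ b₁ b₂ k m := by
    intro h k hk hkn
    rw [hk, vartheta_inner_eq h k m hk, binom_natCast,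
      ← mul_sum_binom_eq_stepCoeff ha₁ ha₂ hb₁ hb₂]
    obtain ⟨p, rfl⟩ := Nat.exists_eq_add_of_le hkn
    have e1 : (a₁ * b₁ / (a₂ * b₂)) ^ m * (4 * a₂ * b₂ / (4 * δ ^ 2)) ^ m =
        (b₁ / b₂) ^ m * (a₁ * b₂ / δ ^ 2) ^ m := by
      rw [← mul_zpow, ← mul_zpow]
      congr 1
      field_simp
    have e2 : (a₁ * b₂ / δ ^ 2) ^ m * (4 * a₁ * b₂ / (4 * δ ^ 2)) ^ h =
        (a₁ * b₂) ^ k / (δ ^ 2) ^ k := by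
      have e3 : 4 * a₁ * b₂ / (4 * δ ^ 2) = a₁ * b₂ / δ ^ 2 := by field_simp
      rw [e3, ← zpow_natCast _ h, ← zpow_add₀ (by positivity), add_comm, hk, zpow_natCast, div_pow]
    have e4 : δ ^ (2 * (k + p)) = (δ ^ 2) ^ k * (δ ^ 2) ^ p := by rw [pow_mul, pow_add]
    rw [Nat.add_sub_cancel_left]
    generalize ∑ l ∈ Finset.range ((k : ℤ) - m + 1).toNat,
      binom k l * binom k (m + l) * (a₂ * b₁ / (a₁ * b₂)) ^ l = S
    calc _ = δ ^ (2 * (k + p)) *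
          ((a₁ * b₁ / (a₂ * b₂)) ^ m * (4 * a₂ * b₂ / (4 * δ ^ 2)) ^ m) *
            (4 * a₁ * b₂ / (4 * δ ^ 2)) ^ h * (k + p).choose k * S := by ring
      _ = δ ^ (2 * (k + p)) * (b₁ / b₂) ^ m *
          ((a₁ * b₂ / δ ^ 2) ^ m * (4 * a₁ * b₂ / (4 * δ ^ 2)) ^ h) * (k + p).choose k * S := by
            rw [e1]; ring
      _ = _ := by
        rw [e2, e4]
        field_simp
  -- The index ranges need not correspond: terms with `h + m < 0` vanish through `binom`, and those
  -- with `k < m` through `stepCoeff`.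
  refine Finset.sum_bij_ne_zero (fun h _ _ => ((h : ℤ) + m).toNat) ?_ ?_ ?_ ?_
  · intro h hh _
    rw [Finset.mem_range] at hh ⊢
    omega
  · intro h _ hh0 h' _ hh0' heq
    have nn : ∀ h : ℕ, binom n (h + m) ≠ 0 → 0 ≤ (h : ℤ) + m := fun h h1 => by
      by_contra h2
      exact h1 (binom_of_neg_right _ (by omega))
    have h1 := nn h (left_ne_zero_of_mul (left_ne_zero_of_mul (right_ne_zero_of_mul hh0)))
    have h2 := nn h' (left_ne_zero_of_mul (left_ne_zero_of_mul (right_ne_zero_of_mul hh0')))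
    omega
  · intro k hk hk0
    rw [Finset.mem_range] at hk
    have hmk : m ≤ k := by
      by_contra h
      exact right_ne_zero_of_mul hk0 (stepCoeff_eq_zero _ _ _ _ (by omega))
    refine ⟨((k : ℤ) - m).toNat, Finset.mem_range.2 (by omega), ?_, by omega⟩
    rwa [term _ k (by omega) (by omega)]
  · intro h hh hh0
    rw [Finset.mem_range] at hh
    have h1 : 0 ≤ (h : ℤ) + m := by
      by_contra h2
      refine hh0 ?_
      rw [binom_of_neg_right _ (by omega : (h : ℤ) + m < 0)]
      simp
    exact term _ _ (by omega) (by omega)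

theorem evenCoeff_zero (n : ℕ) (m : ℤ) :
    evenCoeff a₁ a₂ b₁ b₂ 0 n m = stepCoeff a₁ a₂ b₁ b₂ n m := by
  rw [evenCoeff, Finset.sum_range_succ, Finset.sum_eq_zero]
  · simp
  · intro k hk
    rw [Finset.mem_range] at hk
    rw [zero_pow two_ne_zero, zero_pow (by omega), mul_zero, zero_mul]

end Coefficients

theorem hasSum_even_add_odd {f : ℕ → ℝ} {S : ℝ} (hf : HasSum f S) :
    HasSum (fun n => f (2 * n) + f (2 * n + 1)) S := by
  have he := (hf.summable.comp_injective (i := fun n : ℕ => 2 * n)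
    fun a b h => by simpa using h).hasSum
  have ho := (hf.summable.comp_injective (i := fun n : ℕ => 2 * n + 1)
    fun a b h => by simpa using h).hasSum
  rw [hf.unique (he.even_add_odd ho)]
  exact he.add ho

theorem hasSumFrom_of_hasSum {m : ℤ} {f g : ℕ → ℝ} {S : ℝ} (hg : HasSum g S)
    (h0 : ∀ n, n < m.natAbs → g n = 0) (hfg : ∀ n, f n = g n) : HasSumFrom m f S := by
  obtain rfl : f = g := funext hfg
  refine (hasSum_subtype_iff_of_support_subset fun n hn => ?_).2 hg
  by_contra h
  exact hn (h0 n (by simpa using h))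

/-! ### Series for the chain, by parity of the displacement -/

section Chain

variable {Ω : Type*} [MeasurableSpace Ω] {P : ℤ → Measure Ω} {X : ℝ≥0 → Ω → ℤ}
  {α₁ α₂ β₁ β₂ : ℝ}

/-- Here `σ` is the mean of the two exit rates, so the diagonal entries are `δ - σ` at even sites
and `-δ - σ` at odd ones. -/
theorem sum_rates_mul (f : ℤ → ℝ) (k : ℤ) :
    ∑ m ∈ ({k - 1, k, k + 1} : Finset ℤ), rates α₁ α₂ β₁ β₂ k m * f m =
      genOp α₁ α₂ β₁ β₂ ((β₁ + β₂ - α₁ - α₂) / 2) f k -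
        (α₁ + α₂ + β₁ + β₂) / 2 * f k := by
  rw [Finset.sum_insert (by simp; omega), Finset.sum_pair (by simp), genOp_apply]
  have h1 : k - 1 ≠ k + 1 := by omega
  have h2 : k ≠ k - 1 := by omega
  simp only [rates, h1, h2, if_true, if_false, left_eq_add, one_ne_zero]
  split_ifs <;> ring

theorem IsMarkovChain.hasSum_stateProb (hX : IsMarkovChain P X)
    (hG : HasGenerator P X (rates α₁ α₂ β₁ β₂)) (hα₁ : 0 < α₁) (hα₂ : 0 < α₂) (hβ₁ : 0 < β₁)
    (hβ₂ : 0 < β₂) (k z : ℤ) (t : ℝ≥0) :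
    HasSum (fun i : ℕ => (t : ℝ) ^ i / i.factorial *
      (genOp α₁ α₂ β₁ β₂ ((β₁ + β₂ - α₁ - α₂) / 2) ^ i) (Pi.single z 1) k)
      (Real.exp ((α₁ + α₂ + β₁ + β₂) / 2 * t) * stateProb P X k z t) := by
  set σ := (α₁ + α₂ + β₁ + β₂) / 2 with hσ
  have hσ0 : 0 < σ := by positivity
  set u : ℤ → ℝ → ℝ := fun k x => Real.exp (σ * x) * stateProb P X k z x.toNNReal with hu
  have h0 : (fun m => u m 0) = Pi.single z 1 := by
    ext m
    simp [hu, hX.stateProb_zero, Pi.single_apply, eq_comm]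
  have key := hasSum_taylor (L := genOp α₁ α₂ β₁ β₂ ((β₁ + β₂ - α₁ - α₂) / 2)) (u := u)
    (M := Real.exp (σ * t)) t.2
    (genOp_supBounded hα₁.le hα₂.le hβ₁.le hβ₂.le _) (fun k => ?_) (fun k x hx => ?_)
    (fun k x hx => ?_) k
  · rw [h0] at key
    simpa only [hu, NNReal.val_eq_coe, Real.toNNReal_coe] using key
  · have := (hX.continuous_stateProb hG k z).comp continuous_real_toNNReal
    exact ((by fun_prop : Continuous fun x : ℝ => Real.exp (σ * x)).mul this).continuousOn
  · have hrow : ∑ m ∈ ({k - 1, k, k + 1} : Finset ℤ), rates α₁ α₂ β₁ β₂ k m = 0 := by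
      -- The row sum is the action of the generator on the constant function `1`.
      have := sum_rates_mul (α₁ := α₁) (α₂ := α₂) (β₁ := β₁) (β₂ := β₂) (fun _ => 1) k
      simp only [mul_one, genOp_apply] at this
      rw [this]
      split_ifs <;> ring
    have h1 := hX.hasDerivWithinAt_stateProb hG k z (by simp) hrow hx.1
    have h2 : HasDerivAt (fun x : ℝ => Real.exp (σ * x)) (Real.exp (σ * x) * σ) x := by
      simpa using ((hasDerivAt_id x).const_mul σ).exp
    have h3 := h2.hasDerivWithinAt (s := Set.Ici x) |>.mul h1
    rw [sum_rates_mul (fun m => stateProb P X m z x.toNNReal)] at h3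
    refine h3.congr_deriv ?_
    have h4 : (fun m => u m x) =
        Real.exp (σ * x) • fun m => stateProb P X m z x.toNNReal := rfl
    rw [h4, map_smul, Pi.smul_apply, smul_eq_mul]
    ring
  · have h1 := stateProb_nonneg (P := P) (X := X) k z x.toNNReal
    rw [abs_of_nonneg (by positivity)]
    calc _ ≤ Real.exp (σ * x) * 1 := 
        mul_le_mul_of_nonneg_left (hX.stateProb_le_one _ _ _) (Real.exp_pos _).le
      _ ≤ _ := by
        rw [mul_one]
        exact Real.exp_le_exp.2 (mul_le_mul_of_nonneg_left hx.2 hσ0.le)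

theorem summable_evenCoeff (hα₁ : 0 < α₁) (hα₂ : 0 < α₂) (hβ₁ : 0 < β₁) (hβ₂ : 0 < β₂)
    (δ t : ℝ) (m : ℤ) : Summable fun n : ℕ =>
      t ^ (2 * n + 1) / (2 * n + 1).factorial * evenCoeff α₁ α₂ β₁ β₂ δ n m := by
  set C := 1 + |δ| + α₁ + α₂ + β₁ + β₂ with hC
  have hC0 : 0 < C := by positivity
  -- The entry of `L^{2n}` is paired with `(2n + 1)!`, hence the exponent `i - 1` at `i = 2n + 1`.
  -- The summand `1` in `C` gives `C ≥ 1`, so that `C^{i-1} ≤ C^i`.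
  have hb : ∀ i : ℕ, |(genOp α₁ α₂ β₁ β₂ δ ^ (i - 1)) (Pi.single (0 + 2 * m) 1) 0| ≤
      C ^ i * 1 := by
    intro i
    refine ((genOp_supBounded hα₁.le hα₂.le hβ₁.le hβ₂.le δ).pow_apply_le (M := 1)
      (fun k => ?_) (i - 1) 0).trans ?_
    · rw [Pi.single_apply]
      split_ifs <;> simp
    · gcongr
      · linarith [abs_nonneg δ]
      · omega
  have := (summable_pow_div_factorial_mul t hb).comp_injective (i := fun n : ℕ => 2 * n + 1)
    fun a b h => by simpa using h
  refine this.congr fun n => ?_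
  simp only [Function.comp_apply, Nat.add_sub_cancel, genOp_pow_two_mul_single]

theorem exists_stateProb_eq_of_hasSum {k z : ℤ} {t : ℝ≥0} {f : ℕ → ℝ} {g : ℕ → ℝ} {σ : ℝ}
    {m : ℤ} (hf : HasSum f (Real.exp (σ * t) * stateProb P X k z t))
    (h0 : ∀ n, n < m.natAbs → f n = 0) (hfg : ∀ n, g n = f n) :
    ∃ S, HasSumFrom m g S ∧ stateProb P X k z t = Real.exp (-σ * t) * S := by
  refine ⟨_, hasSumFrom_of_hasSum hf h0 hfg, ?_⟩
  rw [← mul_assoc, ← Real.exp_add, neg_mul, neg_add_cancel, Real.exp_zero, one_mul]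

/-- In an odd power, the hops of the extra `L` land at odd distance from `k`, where entries of
`L^{2n}` vanish; only the diagonal `±δ` survives. -/
theorem IsMarkovChain.hasSum_stateProb_same_parity (hX : IsMarkovChain P X)
    (hG : HasGenerator P X (rates α₁ α₂ β₁ β₂)) (hα₁ : 0 < α₁) (hα₂ : 0 < α₂) (hβ₁ : 0 < β₁)
    (hβ₂ : 0 < β₂) (k m : ℤ) (t : ℝ≥0) {δ ε : ℝ} (hδ : δ = (β₁ + β₂ - α₁ - α₂) / 2)
    (hε : ε = if Even k then δ else -δ) :
    HasSum (fun n : ℕ => ((t : ℝ) ^ (2 * n) / (2 * n).factorial +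
        (t : ℝ) ^ (2 * n + 1) / (2 * n + 1).factorial * ε) * evenCoeff α₁ α₂ β₁ β₂ δ n m)
      (Real.exp ((α₁ + α₂ + β₁ + β₂) / 2 * t) * stateProb P X k (k + 2 * m) t) := by
  refine (hasSum_even_add_odd
    (hX.hasSum_stateProb hG hα₁ hα₂ hβ₁ hβ₂ k (k + 2 * m) t)).congr_fun fun n => ?_
  rw [← hδ, genOp_pow_two_mul_single, pow_succ (genOp _ _ _ _ _), Module.End.mul_apply, add_mul]
  congr 1
  rw [mul_assoc]
  congr 1
  have h1 := genOp_pow_two_mul_single_of_odd α₁ α₂ β₁ β₂ δ n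
    (k := k) (z := k + 2 * m - 1) (by rw [Int.even_iff]; omega)
  have h2 := genOp_pow_two_mul_single_of_odd α₁ α₂ β₁ β₂ δ n
    (k := k) (z := k + 2 * m + 1) (by rw [Int.even_iff]; omega)
  by_cases hk : Even k
  · rw [genOp_single_even _ _ _ _ _ (hk.add (even_two_mul m)), if_pos hk] at *
    simp [h1, h2, hε, genOp_pow_two_mul_single]
  · have hk' : ¬ Even (k + 2 * m) := by rw [Int.even_iff] at *; omega
    rw [genOp_single_odd _ _ _ _ _ hk', if_neg hk] at *
    simp [h1, h2, hε, genOp_pow_two_mul_single]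

/-- Even powers and the diagonal term vanish by parity. The last hop enters the target from below or
from above, at distance `2m` or `2(m + 1)` from `k`, giving two series whose convergence is
established separately. -/
theorem IsMarkovChain.exists_hasSum_stateProb_opp_parity (hX : IsMarkovChain P X)
    (hG : HasGenerator P X (rates α₁ α₂ β₁ β₂)) (hα₁ : 0 < α₁) (hα₂ : 0 < α₂) (hβ₁ : 0 < β₁)
    (hβ₂ : 0 < β₂) (k m : ℤ) (t : ℝ≥0) {δ : ℝ} (hδ : δ = (β₁ + β₂ - α₁ - α₂) / 2) :
    ∃ S₁ S₂ : ℝ,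
      HasSum (fun n : ℕ => (t : ℝ) ^ (2 * n + 1) / (2 * n + 1).factorial *
        evenCoeff α₁ α₂ β₁ β₂ δ n m) S₁ ∧
      HasSum (fun n : ℕ => (t : ℝ) ^ (2 * n + 1) / (2 * n + 1).factorial *
        evenCoeff α₁ α₂ β₁ β₂ δ n (m + 1)) S₂ ∧
      stateProb P X k (k + 2 * m + 1) t = Real.exp (-((α₁ + α₂ + β₁ + β₂) / 2) * t) *
        ((if Even k then α₁ else β₁) * S₁ + (if Even k then α₂ else β₂) * S₂) := by
  have hS₁ := (summable_evenCoeff hα₁ hα₂ hβ₁ hβ₂ δ t m).hasSum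
  have hS₂ := (summable_evenCoeff hα₁ hα₂ hβ₁ hβ₂ δ t (m + 1)).hasSum
  refine ⟨_, _, hS₁, hS₂, ?_⟩
  have h := hasSum_even_add_odd
    (hX.hasSum_stateProb hG hα₁ hα₂ hβ₁ hβ₂ k (k + 2 * m + 1) t)
  have h' := (hS₁.mul_left (if Even k then α₁ else β₁)).add
    (hS₂.mul_left (if Even k then α₂ else β₂))
  rw [← h.unique (h'.congr_fun fun n => ?_), ← mul_assoc, ← Real.exp_add, neg_mul,
    neg_add_cancel, Real.exp_zero, one_mul]
  have h0 := genOp_pow_two_mul_single_of_odd α₁ α₂ β₁ β₂ δ n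
    (k := k) (z := k + 2 * m + 1) (by rw [Int.even_iff]; omega)
  have e1 : k + 2 * m + 1 - 1 = k + 2 * m := by ring
  have e2 : k + 2 * m + 1 + 1 = k + 2 * (m + 1) := by ring
  rw [← hδ, h0, pow_succ (genOp _ _ _ _ _), Module.End.mul_apply]
  by_cases hk : Even k
  · have hk' : ¬ Even (k + 2 * m + 1) := by rw [Int.even_iff] at *; omega
    rw [genOp_single_odd _ _ _ _ _ hk', if_pos hk, if_pos hk, e1, e2]
    simp only [map_add, map_smul, Pi.add_apply, Pi.smul_apply, smul_eq_mul, h0,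
      genOp_pow_two_mul_single]
    ring
  · have hk' : Even (k + 2 * m + 1) := by rw [Int.even_iff] at *; omega
    rw [genOp_single_even _ _ _ _ _ hk', if_neg hk, if_neg hk, e1, e2]
    simp only [map_add, map_smul, Pi.add_apply, Pi.smul_apply, smul_eq_mul, h0,
      genOp_pow_two_mul_single]
    ring

end Chain
end AlternatingChain
end

/-! ### The explicit formulas -/

open AlternatingChain in
theorem propositionA1 {Ω : Type*} [MeasurableSpace Ω] (P : ℤ → Measure Ω) (X : ℝ≥0 → Ω → ℤ)
    (α₁ α₂ β₁ β₂ : ℝ) (hα₁ : 0 < α₁) (hα₂ : 0 < α₂) (hβ₁ : 0 < β₁) (hβ₂ : 0 < β₂)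
    (hX : IsMarkovChain P X) (hG : HasGenerator P X (rates α₁ α₂ β₁ β₂)) :
    (α₁ + α₂ ≠ β₁ + β₂ → ∀ (r s : ℤ) (t : ℝ≥0),
      (∃ S : ℝ, HasSumFrom (s - r) (fun n =>
          (α₁ * β₁ / (α₂ * β₂)) ^ (s - r) *
            ((t : ℝ) ^ (2 * n) / (2 * n).factorial * ((β₁ + β₂ - α₁ - α₂) / 2) ^ (2 * n) +
              (t : ℝ) ^ (2 * n + 1) / (2 * n + 1).factorial * ((β₁ + β₂ - α₁ - α₂) / 2) ^ (2 * n + 1)) *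
            vartheta n r s α₁ α₂ β₁ β₂) S ∧
        stateProb P X (2 * r) (2 * s) t = Real.exp (-((α₁ + α₂ + β₁ + β₂) / 2) * t) * S) ∧
      (∃ S₁ S₂ : ℝ,
        HasSumFrom (s - r) (fun n =>
          (t : ℝ) ^ (2 * n + 1) / (2 * n + 1).factorial * ((β₁ + β₂ - α₁ - α₂) / 2) ^ (2 * n) *
            (α₁ * β₁ / (α₂ * β₂)) ^ (s - r) * vartheta n r s α₁ α₂ β₁ β₂) S₁ ∧
        HasSumFrom (s - r + 1) (fun n =>
          (t : ℝ) ^ (2 * n + 1) / (2 * n + 1).factorial * ((β₁ + β₂ - α₁ - α₂) / 2) ^ (2 * n) *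
            (α₁ * β₁ / (α₂ * β₂)) ^ (s - r + 1) * vartheta n r (s + 1) α₁ α₂ β₁ β₂) S₂ ∧
        stateProb P X (2 * r) (2 * s + 1) t =
          Real.exp (-((α₁ + α₂ + β₁ + β₂) / 2) * t) * (α₁ * S₁ + α₂ * S₂)) ∧
      (∃ S₁ S₂ : ℝ,
        HasSumFrom (s - r) (fun n =>
          (t : ℝ) ^ (2 * n + 1) / (2 * n + 1).factorial * ((β₁ + β₂ - α₁ - α₂) / 2) ^ (2 * n) *
            (α₁ * β₁ / (α₂ * β₂)) ^ (s - r) * vartheta n r s β₁ β₂ α₁ α₂) S₁ ∧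
        HasSumFrom (s - r - 1) (fun n =>
          (t : ℝ) ^ (2 * n + 1) / (2 * n + 1).factorial * ((β₁ + β₂ - α₁ - α₂) / 2) ^ (2 * n) *
            (α₁ * β₁ / (α₂ * β₂)) ^ (s - r - 1) * vartheta n r (s - 1) β₁ β₂ α₁ α₂) S₂ ∧
        stateProb P X (2 * r + 1) (2 * s) t =
          Real.exp (-((α₁ + α₂ + β₁ + β₂) / 2) * t) * (β₂ * S₁ + β₁ * S₂)) ∧
      (∃ S : ℝ, HasSumFrom (s - r) (fun n =>
          (α₁ * β₁ / (α₂ * β₂)) ^ (s - r) *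
            ((t : ℝ) ^ (2 * n) / (2 * n).factorial * ((β₁ + β₂ - α₁ - α₂) / 2) ^ (2 * n) +
              (t : ℝ) ^ (2 * n + 1) / (2 * n + 1).factorial * ((α₁ + α₂ - β₁ - β₂) / 2) ^ (2 * n + 1)) *
            vartheta n r s β₁ β₂ α₁ α₂) S ∧
        stateProb P X (2 * r + 1) (2 * s + 1) t = Real.exp (-((α₁ + α₂ + β₁ + β₂) / 2) * t) * S)) ∧
    (α₁ + α₂ = β₁ + β₂ → ∀ (r s : ℤ) (t : ℝ≥0),
      (∃ S : ℝ, HasSumFrom (s - r) (fun n =>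
          (α₁ * β₁ / (α₂ * β₂)) ^ (s - r) * ((t : ℝ) ^ (2 * n) / (2 * n).factorial) *
            eta n r s α₁ α₂ β₁ β₂) S ∧
        stateProb P X (2 * r) (2 * s) t = Real.exp (-(α₁ + α₂) * t) * S) ∧
      (∃ S₁ S₂ : ℝ,
        HasSumFrom (s - r) (fun n =>
          (t : ℝ) ^ (2 * n + 1) / (2 * n + 1).factorial *
            (α₁ * β₁ / (α₂ * β₂)) ^ (s - r) * eta n r s α₁ α₂ β₁ β₂) S₁ ∧
        HasSumFrom (s - r + 1) (fun n =>
          (t : ℝ) ^ (2 * n + 1) / (2 * n + 1).factorial *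
            (α₁ * β₁ / (α₂ * β₂)) ^ (s - r + 1) * eta n r (s + 1) α₁ α₂ β₁ β₂) S₂ ∧
        stateProb P X (2 * r) (2 * s + 1) t =
          Real.exp (-(α₁ + α₂) * t) * (α₁ * S₁ + α₂ * S₂)) ∧
      (∃ S₁ S₂ : ℝ,
        HasSumFrom (s - r) (fun n =>
          (t : ℝ) ^ (2 * n + 1) / (2 * n + 1).factorial *
            (α₁ * β₁ / (α₂ * β₂)) ^ (s - r) * eta n r s β₁ β₂ α₁ α₂) S₁ ∧
        HasSumFrom (s - r - 1) (fun n =>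
          (t : ℝ) ^ (2 * n + 1) / (2 * n + 1).factorial *
            (α₁ * β₁ / (α₂ * β₂)) ^ (s - r - 1) * eta n r (s - 1) β₁ β₂ α₁ α₂) S₂ ∧
        stateProb P X (2 * r + 1) (2 * s) t =
          Real.exp (-(α₁ + α₂) * t) * (β₂ * S₁ + β₁ * S₂)) ∧
      (∃ S : ℝ, HasSumFrom (s - r) (fun n =>
          (α₁ * β₁ / (α₂ * β₂)) ^ (s - r) * ((t : ℝ) ^ (2 * n) / (2 * n).factorial) *
            eta n r s β₁ β₂ α₁ α₂) S ∧
        stateProb P X (2 * r + 1) (2 * s + 1) t = Real.exp (-(α₁ + α₂) * t) * S)) := by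
  set δ := (β₁ + β₂ - α₁ - α₂) / 2 with hδ
  have hq : β₁ * α₁ / (β₂ * α₂) = α₁ * β₁ / (α₂ * β₂) := by
    rw [mul_comm β₁, mul_comm β₂]
  have hsame := fun k m t => hX.hasSum_stateProb_same_parity hG hα₁ hα₂ hβ₁ hβ₂ k m t hδ rfl
  have hopp := fun k m t =>
    hX.exists_hasSum_stateProb_opp_parity hG hα₁ hα₂ hβ₁ hβ₂ k m t hδ
  have heven : ∀ r : ℤ, Even (2 * r) := even_two_mul
  have hodd : ∀ r : ℤ, ¬ Even (2 * r + 1) := fun r => by rw [Int.even_iff]; omega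
  have z1 : ∀ r s : ℤ, 2 * r + 2 * (s - r) = 2 * s := fun r s => by ring
  have z2 : ∀ r s : ℤ, 2 * r + 1 + 2 * (s - r - 1) + 1 = 2 * s := fun r s => by ring
  have z3 : ∀ r s : ℤ, 2 * r + 1 + 2 * (s - r) = 2 * s + 1 := fun r s => by ring
  refine ⟨fun hne r s t => ?_, fun heq r s t => ?_⟩
  · have hδ0 : δ ≠ 0 := by
      rw [hδ]
      intro h
      exact hne (by linarith)
    have hA : ∀ n r s, δ ^ (2 * n) * ((α₁ * β₁ / (α₂ * β₂)) ^ (s - r) *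
        vartheta n r s α₁ α₂ β₁ β₂) = evenCoeff α₁ α₂ β₁ β₂ δ n (s - r) :=
      mul_vartheta_eq hα₁ hα₂ hβ₁ hβ₂ hδ0 (by rw [hδ]; ring)
    -- Both `q` and the even coefficients are invariant under exchanging the two pairs of rates.
    have hB : ∀ n r s, δ ^ (2 * n) * ((α₁ * β₁ / (α₂ * β₂)) ^ (s - r) *
        vartheta n r s β₁ β₂ α₁ α₂) = evenCoeff α₁ α₂ β₁ β₂ δ n (s - r) := by
      intro n r s
      rw [← hq, ← evenCoeff_swap]
      exact mul_vartheta_eq hβ₁ hβ₂ hα₁ hα₂ hδ0 (by rw [hδ]; ring) n r s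
    have hneg : (α₁ + α₂ - β₁ - β₂) / 2 = -δ := by rw [hδ]; ring
    refine ⟨?_, ?_, ?_, ?_⟩
    · have h := hsame (2 * r) (s - r) t
      rw [if_pos (heven r), z1] at h
      refine exists_stateProb_eq_of_hasSum h (fun n hn => ?_) (fun n => ?_)
      · rw [evenCoeff_eq_zero _ _ _ _ _ hn, mul_zero]
      · rw [← hA]; ring
    · obtain ⟨S₁, S₂, h₁, h₂, h⟩ := hopp (2 * r) (s - r) t
      rw [if_pos (heven r), if_pos (heven r), z1] at h
      refine ⟨S₁, S₂, hasSumFrom_of_hasSum h₁ (fun n hn => ?_) (fun n => ?_),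
        hasSumFrom_of_hasSum h₂ (fun n hn => ?_) (fun n => ?_), h⟩
      · rw [evenCoeff_eq_zero _ _ _ _ _ hn, mul_zero]
      · rw [← hA]; ring
      · rw [evenCoeff_eq_zero _ _ _ _ _ hn, mul_zero]
      · rw [← add_sub_right_comm, ← hA]; ring
    -- The target `2s` is `k + 2m + 1` with `k = 2r + 1` and `m = s - r - 1`, so the two series
    -- appear in the opposite order to the statement.
    · obtain ⟨S₁, S₂, h₁, h₂, h⟩ := hopp (2 * r + 1) (s - r - 1) t
      rw [if_neg (hodd r), if_neg (hodd r), z2, add_comm (β₁ * S₁)] at h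
      rw [sub_add_cancel] at h₂
      refine ⟨S₂, S₁, hasSumFrom_of_hasSum h₂ (fun n hn => ?_) (fun n => ?_),
        hasSumFrom_of_hasSum h₁ (fun n hn => ?_) (fun n => ?_), h⟩
      · rw [evenCoeff_eq_zero _ _ _ _ _ hn, mul_zero]
      · rw [← hB]; ring
      · rw [evenCoeff_eq_zero _ _ _ _ _ hn, mul_zero]
      · rw [sub_right_comm, ← hB]; ring
    · have h := hsame (2 * r + 1) (s - r) t
      rw [if_neg (hodd r), z3] at h
      refine exists_stateProb_eq_of_hasSum h (fun n hn => ?_) (fun n => ?_)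
      · rw [evenCoeff_eq_zero _ _ _ _ _ hn, mul_zero]
      · rw [← hB, hneg, pow_succ (-δ), (even_two_mul n).neg_pow]; ring
  · have hδ0 : δ = 0 := by
      rw [hδ]
      linarith
    have hσ : (α₁ + α₂ + β₁ + β₂) / 2 = α₁ + α₂ := by linarith
    have hA : ∀ n r s, (α₁ * β₁ / (α₂ * β₂)) ^ (s - r) * eta n r s α₁ α₂ β₁ β₂ =
        evenCoeff α₁ α₂ β₁ β₂ δ n (s - r) := by
      intro n r s
      rw [hδ0, evenCoeff_zero, mul_eta_eq hα₁ hα₂ hβ₁ hβ₂]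
    have hB : ∀ n r s, (α₁ * β₁ / (α₂ * β₂)) ^ (s - r) * eta n r s β₁ β₂ α₁ α₂ =
        evenCoeff α₁ α₂ β₁ β₂ δ n (s - r) := by
      intro n r s
      rw [hδ0, evenCoeff_zero, ← hq, mul_eta_eq hβ₁ hβ₂ hα₁ hα₂, stepCoeff_swap]
    rw [hσ] at hsame hopp
    refine ⟨?_, ?_, ?_, ?_⟩
    · have h := hsame (2 * r) (s - r) t
      rw [if_pos (heven r), z1] at h
      refine exists_stateProb_eq_of_hasSum h (fun n hn => ?_) (fun n => ?_)
      · rw [evenCoeff_eq_zero _ _ _ _ _ hn, mul_zero]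
      · rw [← hA, hδ0]; ring
    · obtain ⟨S₁, S₂, h₁, h₂, h⟩ := hopp (2 * r) (s - r) t
      rw [if_pos (heven r), if_pos (heven r), z1] at h
      refine ⟨S₁, S₂, hasSumFrom_of_hasSum h₁ (fun n hn => ?_) (fun n => ?_),
        hasSumFrom_of_hasSum h₂ (fun n hn => ?_) (fun n => ?_), h⟩
      · rw [evenCoeff_eq_zero _ _ _ _ _ hn, mul_zero]
      · rw [← hA]; ring
      · rw [evenCoeff_eq_zero _ _ _ _ _ hn, mul_zero]
      · rw [← add_sub_right_comm, ← hA]; ring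
    · obtain ⟨S₁, S₂, h₁, h₂, h⟩ := hopp (2 * r + 1) (s - r - 1) t
      rw [if_neg (hodd r), if_neg (hodd r), z2, add_comm (β₁ * S₁)] at h
      rw [sub_add_cancel] at h₂
      refine ⟨S₂, S₁, hasSumFrom_of_hasSum h₂ (fun n hn => ?_) (fun n => ?_),
        hasSumFrom_of_hasSum h₁ (fun n hn => ?_) (fun n => ?_), h⟩
      · rw [evenCoeff_eq_zero _ _ _ _ _ hn, mul_zero]
      · rw [← hB]; ring
      · rw [evenCoeff_eq_zero _ _ _ _ _ hn, mul_zero]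
      · rw [sub_right_comm, ← hB]; ring
    · have h := hsame (2 * r + 1) (s - r) t
      rw [if_neg (hodd r), z3] at h
      refine exists_stateProb_eq_of_hasSum h (fun n hn => ?_) (fun n => ?_)
      · rw [evenCoeff_eq_zero _ _ _ _ _ hn, mul_zero]
      · rw [← hB, hδ0]; ring
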